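/- **Setting.** Let $q=\ell^2$ be an even prime power, let $n>1$ be an integer with $\gcd(n,q)=1$, and let $m$ be the multiplicative order of $q$ modulo $n$. For $a\in\mathbb Z_n=\{0,1,\dots,n-1\}$ let $S_a=\{aq^i \bmod n : i=0,1,2,\dots\}$ be the $q$-cyclotomic coset of $a$ modulo $n$, let $s_a=|S_a|$, and let $\mathcal A$ be the set of all $q$-cyclotomic cosets modulo $n$. The coset $S_b$ is called the dual of $S_a$ if there is $c\in S_b$ with $a+c\equiv 0 \pmod n$. For a set $\mathcal S$ of cosets, $\mathcal S^*$ denotes the set of the duals of the cosets in $\mathcal S$, and $\ell\mathcal S=\{S_{a\ell} : S_a\in\mathcal S\}$. Let $V_{\mathcal S}$ be the $\mathbb F_q$-span of the polynomials $$\sum_{i=0}^{s_a-1}(\gamma x^a)^{q^i}\in\mathbb F_{q^m}[x],\qquad S_a\in\mathcal S,\ \gamma\in\mathbb F_{q^{s_a}}\subseteq\mathbb F_{q^m}$$ (equivalently, $\gamma$ may be restricted to an $\mathbb F_q$-basis of $\mathbb F_{q^{s_a}}$), and let $U_n=\{\beta\in\mathbb F_{q^m}:\beta^n=1\}$. The values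 at points of $U_n\cup\{0\}$ of polynomials in $V_{\mathcal S}$ lie in $\mathbb F_q$, and $$C_{\mathcal S}=\{(f(\beta))_{\beta\in U_n\cup\{0\}} : f\in V_{\mathcal S}\}$$ is an $\mathbb F_q$-linear code of length $n+1$. An $\ell$-ary quantum code $[[N,\kappa,\ge d]]$ is a subspace $Q$ of $(\mathbb C^{\ell})^{\otimes N}$ of dimension $\ell^{\kappa}$ such that for every operator $E=M_1\otimes\cdots\otimes M_N$ with fewer than $d$ factors $M_i\ne I$ one has $PEP=c_EP$ for some scalar $c_E$, where $P$ is the orthogonal projector onto $Q$; if $\kappa=0$, it is required in addition (the usual purity convention) that $PEP=0$ for every such $E$ of trace $0$. **Theorem 5.1.** Let $\mathcal S$ be a set of $q$-cyclotomic cosets modulo $n$ with $\{0\}\in\mathcal S$, let $d\ge 0$ be an integer, and let $\mathcal T=\{\{0\}\}\cup(\mathcal A\setminus(\ell\mathcal S)^*)$. Suppose that $(\ell\mathcal S)^*$ contains every coset $S_a$ with $0\le a\le n-1$ and $a\ge n+2-d$, and that $\mathcal S\subseteq\mathcal T$. Put $k=\dim_{\mathbb F_q}C_{\mathcal S}$.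 Then $2k\le n+1$, and there exists an $\ell$-ary quantum code $[[n+1,\,n+1-2k,\,\ge d]]$. -/

import Mathlib

open Polynomial

/-! ### Cyclotomic cosets -/

/-- The `q`-cyclotomic coset `S_a = {a qⁱ mod n : i = 0, 1, 2, …}` of `a` modulo `n`. -/
def cyclotomicCoset (n q : ℕ) (a : ZMod n) : Set (ZMod n) :=
  {b | ∃ i : ℕ, b = a * (q : ZMod n) ^ i}

/-- The set `𝒜` of all `q`-cyclotomic cosets modulo `n`. -/
def allCosets (n q : ℕ) : Set (Set (ZMod n)) :=
  Set.range (cyclotomicCoset n q)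

/-- The collection `𝒮*` of the duals of the cosets in `𝒮`: `S_b` is dual to `S_a` if there is
`c ∈ S_b` such that `a + c` is divisible by `n`. -/
def dualCosets (n q : ℕ) (S : Set (Set (ZMod n))) : Set (Set (ZMod n)) :=
  {B | ∃ a b : ZMod n, cyclotomicCoset n q a ∈ S ∧ B = cyclotomicCoset n q b ∧
    ∃ c ∈ cyclotomicCoset n q b, a + c = 0}

/-- The collection `l𝒮 = {S_{a l} : S_a ∈ 𝒮}`. -/
def scaleCosets (n q l : ℕ) (S : Set (Set (ZMod n))) : Set (Set (ZMod n)) :=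
  {B | ∃ a : ZMod n, cyclotomicCoset n q a ∈ S ∧ B = cyclotomicCoset n q (a * (l : ZMod n))}

/-- The collection `𝒯 = {{0}} ∪ (𝒜 - (l𝒮)*)`. -/
def hermitianDualCosets (n q l : ℕ) (S : Set (Set (ZMod n))) : Set (Set (ZMod n)) :=
  {{0}} ∪ (allCosets n q \ dualCosets n q (scaleCosets n q l S))

/-! ### The polynomials and the classical code -/

section Code

variable {F K : Type*} [Field F] [Field K] [Algebra F K]

/-- The polynomial `∑_{i < s_a} (γ x^a)^{qⁱ}`, where `s_a = |S_a|` and `a` is represented by an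
integer in `{0, …, n - 1}`. -/
noncomputable def cosetPoly (n q : ℕ) (a : ZMod n) (γ : K) : K[X] :=
  ∑ i ∈ Finset.range (cyclotomicCoset n q a).ncard, (C γ * X ^ a.val) ^ q ^ i

/-- The `F`-space `V_𝒮` spanned by the polynomials `∑_{i < s_a} (γ x^a)^{qⁱ}`, where `S_a ∈ 𝒮` and
`γ` belongs to the subfield with `q ^ s_a` elements, that is, `γ ^ (q ^ s_a) = γ`.
For `q = |F|` these polynomials depend `F`-linearly on `γ`, so letting `γ` run only over an
`F`-basis of that subfield gives the same span. -/
noncomputable def polySpace (F : Type*) {K : Type*} [Field F] [Field K] [Algebra F K]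
    (n q : ℕ) (S : Set (Set (ZMod n))) : Submodule F K[X] :=
  Submodule.span F {f | ∃ (a : ZMod n) (γ : K), cyclotomicCoset n q a ∈ S ∧
    γ ^ q ^ (cyclotomicCoset n q a).ncard = γ ∧ f = cosetPoly n q a γ}

/-- The evaluation points `U_n ∪ {0}`, where `U_n` is the group of `n`-th roots of unity in `K`. -/
abbrev EvalPoint (K : Type*) [Field K] (n : ℕ) : Type _ :=
  {β : K // β ^ n = 1 ∨ β = 0}

/-- The `F`-linear code `C_𝒮 = {(f(β))_{β ∈ U_n ∪ {0}} : f ∈ V_𝒮}`, as a subspace of the space of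
words over `F` indexed by `U_n ∪ {0}`: the values `f(β)`, which lie in `F`, are regarded as
elements of `F`. -/
noncomputable def cosetCode (F K : Type*) [Field F] [Field K] [Algebra F K]
    (n q : ℕ) (S : Set (Set (ZMod n))) : Submodule F (EvalPoint K n → F) where
  carrier := {c | ∃ f ∈ polySpace F (K := K) n q S,
    ∀ β : EvalPoint K n, algebraMap F K (c β) = f.eval (β : K)}
  zero_mem' := ⟨0, Submodule.zero_mem _, fun β => by simp⟩
  add_mem' := by
    rintro c c' ⟨f, hf, hc⟩ ⟨g, hg, hc'⟩
    exact ⟨f + g, Submodule.add_mem _ hf hg, fun β => by simp [hc, hc']⟩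
  smul_mem' := by
    rintro r c ⟨f, hf, hc⟩
    exact ⟨r • f, Submodule.smul_mem _ r hf, fun β => by simp [hc, Algebra.smul_def]⟩

end Code

/-! ### Quantum codes -/

/-- The state space `(ℂ^l)^{⊗ N}` of `N` systems of dimension `l`, in its computational basis,
which is indexed by the words of length `N` over an alphabet of `l` letters. -/
abbrev QuditSpace (l N : ℕ) : Type :=
  EuclideanSpace ℂ (Fin N → Fin l)

/-- The matrix of the tensor product error operator `M₁ ⊗ ⋯ ⊗ M_N` on `(ℂ^l)^{⊗ N}`. -/
def tensorError {l N : ℕ} (M : Fin N → Matrix (Fin l) (Fin l) ℂ) :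
    Matrix (Fin N → Fin l) (Fin N → Fin l) ℂ :=
  Matrix.of fun x y => ∏ i, M i (x i) (y i)

/-- The weight of `M₁ ⊗ ⋯ ⊗ M_N`: the number of systems on which it does not act as the
identity. -/
noncomputable def errorWeight {l N : ℕ} (M : Fin N → Matrix (Fin l) (Fin l) ℂ) : ℕ :=
  {i | M i ≠ 1}.ncard

/-- `Q` detects the error `E`: one has `P E P = c P` for some scalar `c`, where `P` is the
orthogonal projector onto `Q`. -/
def DetectsError {l N : ℕ} (Q : Submodule ℂ (QuditSpace l N))
    (E : Matrix (Fin N → Fin l) (Fin N → Fin l) ℂ) : Prop :=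
  ∃ c : ℂ, ∀ u ∈ Q, ∀ v ∈ Q, inner ℂ u (Matrix.toEuclideanLin E v) = c * inner ℂ u v

/-- `Q` is an `l`-ary quantum code `[[N, κ, ≥ d]]`: a subspace of `(ℂ^l)^{⊗ N}` of dimension `l ^ κ`
which detects every error of weight less than `d`. As usual, a one-dimensional code, for which
detection is automatic, is moreover required to be pure: errors of weight less than `d` and trace
zero map it into its orthogonal complement. -/
def IsQuantumCode (l N κ d : ℕ) (Q : Submodule ℂ (QuditSpace l N)) : Prop :=
  Module.finrank ℂ Q = l ^ κ ∧
  (∀ M : Fin N → Matrix (Fin l) (Fin l) ℂ, errorWeight M < d → DetectsError Q (tensorError M)) ∧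
  (κ = 0 → ∀ M : Fin N → Matrix (Fin l) (Fin l) ℂ, errorWeight M < d →
    (tensorError M).trace = 0 →
    ∀ u ∈ Q, ∀ v ∈ Q, inner ℂ u (Matrix.toEuclideanLin (tensorError M) v) = 0)

/-! The proof joins a computation with power sums to the stabilizer construction.

Put C = C_𝒮. The value of one generator times the l-th power of the value of another is a
combination of powers β^k with k = a q^i + a' l q^j. Multiplication by a primitive n-th root of
unity permutes the evaluation points, so ∑ β^k = 0 unless n ∣ k. Divisibility puts S_a into (l𝒮)*,
and 𝒮 ⊆ 𝒯 then forces a = a' = 0; there the sum is n + 1, which is zero because n is odd. This is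
what the extra point 0 is for, and it makes C Hermitian self-orthogonal
(`cosetCode_self_orthogonal`). If w is orthogonal to C, nondegeneracy of the trace gives ∑ w_β β^a =
0 for S_a ∈ 𝒮. Raising to the power l q^k gives vanishing moments of w^l at the exponents a l q^k,
which modulo n are the negatives of the elements of the cosets in (l𝒮)*. So the moments 0, …, d - 2
vanish, and a Vandermonde argument shows that w ≠ 0 has weight at least d
(`eq_zero_of_orthogonal_of_card_lt`).

On the quantum side, Weyl operators on ℂ^l are indexed by F so that their commutation signs depend
additively on u v^l (`exists_weylSystem_hermitian`). On C the cocycle is therefore symmetric and can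
be removed by phases (`exists_projective_character`); Q is the fixed space of the resulting group.
The weight bound says that C restricts onto any fewer than d positions. Averaging the conjugates of
a short error over these restrictions depolarizes it to a scalar proportional to its trace, which
gives detection and purity together (`exists_stabilizer_code`). -/

/-! ### Signs and projective characters -/

/-- The sign character `a ↦ (-1)ᵃ` of `ℤ/2ℤ`. -/
noncomputable def signChar : AddChar (ZMod 2) ℂ :=
  AddChar.zmodChar 2 (ζ := -1) (by norm_num)

lemma signChar_one : signChar 1 = -1 := by
  have : (1 : ZMod 2).val = 1 := rfl
  simp [signChar, AddChar.zmodChar_apply, this]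

lemma signChar_eq (a : ZMod 2) : signChar a = 1 ∨ signChar a = -1 := by
  fin_cases a
  · exact Or.inl (AddChar.map_zero_eq_one _)
  · exact Or.inr signChar_one

lemma star_signChar (a : ZMod 2) : star (signChar a) = signChar a := by
  rcases signChar_eq a with h | h <;> simp [h]

lemma star_signChar_mul_self (a : ZMod 2) : star (signChar a) * signChar a = 1 := by
  rcases signChar_eq a with h | h <;> simp [h]

/-- An alternating bilinear form over `ℤ/2ℤ` is the polar form of a quadratic function. -/
lemma exists_quadratic_of_isAlt {V : Type*} [AddCommGroup V] [Module (ZMod 2) V]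
    [FiniteDimensional (ZMod 2) V] (B : LinearMap.BilinForm (ZMod 2) V)
    (hsymm : ∀ u v, B u v = B v u) (halt : ∀ u, B u u = 0) :
    ∃ f : V → ZMod 2, ∀ u v, f (u + v) = f u + f v + B u v := by
  let b := Module.finBasis (ZMod 2) V
  -- The strict upper triangle of the Gram matrix: the diagonal is zero, and symmetry supplies the
  -- lower triangle.
  refine ⟨fun u => ∑ i, ∑ j, if i < j then B (b i) (b j) * b.repr u i * b.repr u j else 0, ?_⟩
  intro u v
  have hB : B u v = ∑ i, ∑ j, B (b i) (b j) * b.repr u i * b.repr v j := by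
    conv_lhs => rw [← b.sum_repr u, ← b.sum_repr v]
    simp only [map_sum, LinearMap.sum_apply, map_smul, LinearMap.smul_apply, smul_eq_mul]
    simp only [Finset.mul_sum]
    rw [Finset.sum_comm]
    exact Finset.sum_congr rfl fun i _ => Finset.sum_congr rfl fun j _ => by ring
  have hswap : ∑ i, ∑ j, (if i < j then B (b i) (b j) * b.repr v i * b.repr u j else 0)
      = ∑ i, ∑ j, (if j < i then B (b i) (b j) * b.repr u i * b.repr v j else 0) := by
    rw [Finset.sum_comm]
    refine Finset.sum_congr rfl fun i _ => Finset.sum_congr rfl fun j _ => ?_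
    rw [hsymm (b j) (b i)]
    split_ifs <;> ring
  have hsplit : B u v
      = ∑ i, ∑ j, (if i < j then B (b i) (b j) * b.repr u i * b.repr v j else 0)
        + ∑ i, ∑ j, (if i < j then B (b i) (b j) * b.repr v i * b.repr u j else 0) := by
    rw [hswap, hB, ← Finset.sum_add_distrib]
    refine Finset.sum_congr rfl fun i _ => ?_
    rw [← Finset.sum_add_distrib]
    refine Finset.sum_congr rfl fun j _ => ?_
    rcases lt_trichotomy i j with h | h | h
    · simp [h, not_lt.mpr h.le]
    · simp [h, halt]
    · simp [h, not_lt.mpr h.le]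
  rw [hsplit]
  simp only [← Finset.sum_add_distrib]
  refine Finset.sum_congr rfl fun i _ => Finset.sum_congr rfl fun j _ => ?_
  split_ifs
  · simp only [map_add, Finsupp.add_apply]; ring
  · simp

/-- The cocycle `(-1) ^ B(u, v)` of a symmetric bilinear form over `ℤ/2ℤ` is a coboundary with
values of modulus one. -/
lemma exists_projective_character {V : Type*} [AddCommGroup V] [Module (ZMod 2) V]
    [FiniteDimensional (ZMod 2) V] (B : LinearMap.BilinForm (ZMod 2) V)
    (hsymm : ∀ u v, B u v = B v u) :
    ∃ ε : V → ℂ, (∀ u, star (ε u) * ε u = 1) ∧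
      ∀ u v, ε u * ε v * signChar (B u v) = ε (u + v) := by
  have hadd : ∀ u v, B (u + v) (u + v) = B u u + B v v := by
    intro u v
    simp only [map_add, LinearMap.add_apply, hsymm v u]
    have : B u v + B u v = 0 := CharTwo.add_self_eq_zero _
    linear_combination this
  -- The diagonal of a symmetric form is additive in characteristic two. Subtracting D ⊗ D leaves an
  -- alternating form, handled by a sign; D ⊗ D itself needs a fourth root of unity.
  let D : V →+ ZMod 2 := AddMonoidHom.mk' (fun u => B u u) hadd
  let D' : V →ₗ[ZMod 2] ZMod 2 := D.toZModLinearMap 2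
  have hD : ∀ u, D' u = B u u := fun _ => rfl
  have hsq : ∀ x : ZMod 2, x * x = x := by decide
  obtain ⟨f, hf⟩ := exists_quadratic_of_isAlt (B - LinearMap.mk₂ (ZMod 2) (fun u v => D' u * D' v)
      (by intros; simp [add_mul]) (by intros; simp [mul_assoc])
      (by intros; simp [mul_add]) (by intros; simp [mul_left_comm]))
    (by intro u v; simp [hsymm u v, mul_comm]) (by intro u; simp [hD, hsq])
  -- The sign makes up for the carry in 1 + 1 = 0, where I * I = -1.
  have hI : ∀ x y : ZMod 2, Complex.I ^ x.val * Complex.I ^ y.val * signChar (x * y)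
      = Complex.I ^ (x + y).val := by
    have h1 : (1 : ZMod 2).val = 1 := rfl
    intro x y
    have : ∀ z : ZMod 2, z = 0 ∨ z = 1 := by decide
    rcases this x with rfl | rfl <;> rcases this y with rfl | rfl
    · simp
    · simp [h1]
    · simp [h1]
    · have h2 : (1 : ZMod 2) + 1 = 0 := rfl
      simp [h1, h2, signChar_one]
  refine ⟨fun u => Complex.I ^ (D' u).val * signChar (f u), fun u => ?_, fun u v => ?_⟩
  · have : star (Complex.I) * Complex.I = 1 := by simp
    calc _ = (star Complex.I * Complex.I) ^ (D' u).val
          * (star (signChar (f u)) * signChar (f u)) := by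
          rw [star_mul', star_pow, mul_pow]; ring
      _ = 1 := by rw [this, star_signChar_mul_self, one_pow, one_mul]
  · have hBuv : B u v = D' u * D' v + (B u v - D' u * D' v) := by ring
    have hf' : f (u + v) = f u + f v + (B u v - D' u * D' v) := by simpa using hf u v
    simp only [map_add]
    rw [← hI, hf', hBuv]
    simp only [AddChar.map_add_eq_mul, add_sub_cancel_left]
    ring

lemma signChar_sum {ι : Type*} (s : Finset ι) (f : ι → ZMod 2) :
    signChar (∑ i ∈ s, f i) = ∏ i ∈ s, signChar (f i) := by
  classical
  induction s using Finset.induction_on with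
  | empty => simp
  | insert a s ha ih => rw [Finset.sum_insert ha, Finset.prod_insert ha, AddChar.map_add_eq_mul, ih]

/-! ### Tensor products of local operators -/

section Tensor

variable {l N : ℕ}

lemma tensorError_mul (M M' : Fin N → Matrix (Fin l) (Fin l) ℂ) :
    tensorError M * tensorError M' = tensorError fun i => M i * M' i := by
  ext x y
  simp only [tensorError, Matrix.mul_apply, Matrix.of_apply, Finset.prod_univ_sum,
    Fintype.piFinset_univ, Finset.prod_mul_distrib]

lemma tensorError_conjTranspose (M : Fin N → Matrix (Fin l) (Fin l) ℂ) :
    (tensorError M).conjTranspose = tensorError fun i => (M i).conjTranspose := by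
  ext x y
  simp [tensorError]

lemma tensorError_smul (c : Fin N → ℂ) (M : Fin N → Matrix (Fin l) (Fin l) ℂ) :
    (tensorError fun i => c i • M i) = (∏ i, c i) • tensorError M := by
  ext x y
  simp [tensorError, Finset.prod_mul_distrib]

lemma tensorError_one : (tensorError fun _ : Fin N => (1 : Matrix (Fin l) (Fin l) ℂ)) = 1 := by
  ext x y
  by_cases h : x = y
  · subst h; simp [tensorError]
  · obtain ⟨i, hi⟩ := Function.ne_iff.mp h
    simp only [tensorError, Matrix.of_apply, Matrix.one_apply_ne h]
    exact Finset.prod_eq_zero (Finset.mem_univ i) (Matrix.one_apply_ne hi)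

lemma trace_tensorError (M : Fin N → Matrix (Fin l) (Fin l) ℂ) :
    (tensorError M).trace = ∏ i, (M i).trace := by
  simp only [tensorError, Matrix.trace, Matrix.diag_apply, Matrix.of_apply, Finset.prod_univ_sum,
    Fintype.piFinset_univ]

lemma sum_tensorError {V : Type*} (t : Fin N → Finset V)
    (M : Fin N → V → Matrix (Fin l) (Fin l) ℂ) :
    ∑ y ∈ Fintype.piFinset t, (tensorError fun i => M i (y i))
      = tensorError fun i => ∑ v ∈ t i, M i v := by
  ext x z
  simp only [tensorError, Matrix.sum_apply, Matrix.of_apply, Finset.prod_univ_sum]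

end Tensor

/-! ### Weyl systems and stabilizer codes -/

/-- A projective representation of an elementary abelian `2`-group `V` on `ℂ^l` by unitary
operators, with cocycle given by a bilinear form, which is irreducible and faithful in the sense
that averaging over it is the depolarizing map and that nontrivial elements are traceless. -/
structure WeylSystem (V : Type*) [AddCommGroup V] [Module (ZMod 2) V] [Fintype V] (l : ℕ) where
  /-- The operators. -/
  op : V → Matrix (Fin l) (Fin l) ℂ
  /-- The form whose sign is the cocycle. -/
  form : LinearMap.BilinForm (ZMod 2) V
  op_mul : ∀ u v, op u * op v = signChar (form u v) • op (u + v)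
  op_zero : op 0 = 1
  trace_op : ∀ u, u ≠ 0 → (op u).trace = 0
  conjTranspose_op_mul : ∀ u, (op u).conjTranspose * op u = 1
  twirl : ∀ M : Matrix (Fin l) (Fin l) ℂ,
    ∑ u, (op u).conjTranspose * M * op u = ((l : ℂ) * M.trace) • 1

lemma trace_toEuclideanLin {m : Type*} [Fintype m] [DecidableEq m] (A : Matrix m m ℂ) :
    LinearMap.trace ℂ _ (Matrix.toEuclideanLin A) = A.trace := by
  change LinearMap.trace ℂ _ (Matrix.toLpLin 2 2 A) = _
  rw [Matrix.toLpLin_eq_toLin, Matrix.trace_toLin_eq]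

/-- When `T` fixes `u` and `v`, this says that conjugating an error by `T` does not change its
matrix element between them. -/
lemma inner_toEuclideanLin_conj {m : Type*} [Fintype m] [DecidableEq m] (T M : Matrix m m ℂ)
    (u v : EuclideanSpace ℂ m) :
    inner ℂ (Matrix.toEuclideanLin T u) (Matrix.toEuclideanLin M (Matrix.toEuclideanLin T v))
      = inner ℂ u (Matrix.toEuclideanLin (T.conjTranspose * M * T) v) := by
  rw [Matrix.toLpLin_mul_same, Matrix.toLpLin_mul_same,
    Matrix.toEuclideanLin_conjTranspose_eq_adjoint]
  simp only [LinearMap.comp_apply]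
  rw [LinearMap.adjoint_inner_right]

namespace WeylSystem

variable {V : Type*} [AddCommGroup V] [Module (ZMod 2) V] [Fintype V] {l : ℕ}
  (W : WeylSystem V l) {N : ℕ}

/-- The tensor product operator attached to a word over `V`. -/
def wordOp (u : Fin N → V) : Matrix (Fin N → Fin l) (Fin N → Fin l) ℂ :=
  tensorError fun i => W.op (u i)

lemma wordOp_mul (u v : Fin N → V) :
    W.wordOp u * W.wordOp v = signChar (∑ i, W.form (u i) (v i)) • W.wordOp (u + v) := by
  simp only [wordOp, tensorError_mul, W.op_mul, tensorError_smul, Pi.add_apply,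
    signChar_sum]

lemma wordOp_zero : W.wordOp (0 : Fin N → V) = 1 := by
  simp only [wordOp, Pi.zero_apply, W.op_zero, tensorError_one]

lemma trace_wordOp {u : Fin N → V} (hu : u ≠ 0) : (W.wordOp u).trace = 0 := by
  obtain ⟨i, hi⟩ := Function.ne_iff.mp hu
  rw [wordOp, trace_tensorError]
  exact Finset.prod_eq_zero (Finset.mem_univ i) (W.trace_op _ hi)

/-- The form on words induced by the form of a Weyl system. -/
noncomputable def wordForm (N : ℕ) : LinearMap.BilinForm (ZMod 2) (Fin N → V) :=
  ∑ i, W.form.compl₁₂ (LinearMap.proj i) (LinearMap.proj i)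

lemma wordForm_apply (u v : Fin N → V) : W.wordForm N u v = ∑ i, W.form (u i) (v i) := by
  simp [wordForm]

/-- Averaging the conjugates of a tensor product of local operators over the words which are
arbitrary on the support `A` and vanish off it. -/
lemma sum_conj_wordOp [DecidableEq V] (M : Fin N → Matrix (Fin l) (Fin l) ℂ)
    (A : Finset (Fin N)) (hA : ∀ i ∉ A, M i = 1) :
    ∑ y ∈ Fintype.piFinset fun i => if i ∈ A then (Finset.univ : Finset V) else {0},
        (tensorError fun i => (W.op (y i)).conjTranspose * M i * W.op (y i))
      = (∏ i, if i ∈ A then (l : ℂ) * (M i).trace else 1) • 1 := by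
  rw [sum_tensorError _ fun i v => (W.op v).conjTranspose * M i * W.op v, ← tensorError_one,
    ← tensorError_smul]
  congr 1
  funext i
  split_ifs with h
  · exact W.twirl _
  · simp [hA i h, W.op_zero]

/-- The stabilizer code of a self-orthogonal group `D` of words whose restriction to any fewer than
`d` positions is onto is a pure code of distance at least `d`. -/
theorem exists_stabilizer_code (hl : l ≠ 0) (D : Submodule (ZMod 2) (Fin N → V)) (d : ℕ)
    (hsymm : ∀ u ∈ D, ∀ v ∈ D, W.wordForm N u v = W.wordForm N v u)
    (hres : ∀ A : Finset (Fin N), A.card < d → ∀ y : Fin N → V, ∃ u ∈ D, ∀ i ∈ A, u i = y i) :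
    ∃ Q : Submodule ℂ (QuditSpace l N),
      Module.finrank ℂ Q * Nat.card D = l ^ N ∧
      ∀ M : Fin N → Matrix (Fin l) (Fin l) ℂ, errorWeight M < d →
        ∃ c : ℂ, ((tensorError M).trace = 0 → c = 0) ∧
          ∀ u ∈ Q, ∀ v ∈ Q,
            inner ℂ u (Matrix.toEuclideanLin (tensorError M) v) = c * inner ℂ u v := by
  classical
  obtain ⟨ε, hε, hεmul⟩ := exists_projective_character ((W.wordForm N).compl₁₂ D.subtype D.subtype)
    fun u v => hsymm u u.2 v v.2
  have : Fintype D := Fintype.ofFinite D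
  let T : D → Matrix (Fin N → Fin l) (Fin N → Fin l) ℂ := fun u => ε u • W.wordOp (u : Fin N → V)
  have hT : ∀ u v, T u * T v = T (u + v) := by
    intro u v
    have := hεmul u v
    simp only [LinearMap.compl₁₂_apply, Submodule.subtype_apply, wordForm_apply] at this
    simp only [T, smul_mul_smul_comm, W.wordOp_mul, smul_smul, this, Submodule.coe_add]
  have hε0 : ε 0 = 1 := by
    have h0 : ε 0 ≠ 0 := fun h => by simpa [h] using hε 0
    have := hεmul 0 0
    simp only [map_zero, AddChar.map_zero_eq_one, mul_one, add_zero] at this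
    exact mul_right_cancel₀ h0 (by rw [this, one_mul])
  have hcard : (Fintype.card D : ℂ) ≠ 0 := Nat.cast_ne_zero.mpr Fintype.card_ne_zero
  -- The average of the representation `T` of `D`, an idempotent onto the vectors fixed by every `T
  -- u`.
  let P : Matrix (Fin N → Fin l) (Fin N → Fin l) ℂ := (Fintype.card D : ℂ)⁻¹ • ∑ u, T u
  have hTP : ∀ u, T u * P = P := by
    intro u
    simp only [P, Matrix.mul_smul, Finset.mul_sum, hT]
    congr 1
    exact Fintype.sum_equiv (Equiv.addLeft u) _ _ fun v => rfl
  have hPP : P * P = P := by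
    conv_lhs => enter [1]; simp only [P]
    rw [Matrix.smul_mul, Finset.sum_mul, Finset.sum_congr rfl fun u _ => hTP u,
      Finset.sum_const, Finset.card_univ, ← Nat.cast_smul_eq_nsmul ℂ, smul_smul,
      inv_mul_cancel₀ hcard, one_smul]
  -- Only the identity word has nonzero trace; the trace of an idempotent is its rank.
  have htrace : P.trace = (Fintype.card D : ℂ)⁻¹ * (l : ℂ) ^ N := by
    simp only [P, Matrix.trace_smul, Matrix.trace_sum, smul_eq_mul]
    rw [Finset.sum_eq_single 0]
    · simp [T, hε0, W.wordOp_zero]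
    · intro u _ hu
      simp [T, W.trace_wordOp (fun h => hu (Subtype.ext h) : (u : Fin N → V) ≠ 0)]
    · simp
  let Pl := Matrix.toEuclideanLin P
  have hidem : IsIdempotentElem Pl := by
    change Pl ∘ₗ Pl = Pl
    rw [← Matrix.toLpLin_mul_same, hPP]
  refine ⟨LinearMap.range Pl, ?_, ?_⟩
  · have h1 := (LinearMap.IsIdempotentElem.isProj_range Pl hidem).trace
    rw [trace_toEuclideanLin, htrace] at h1
    rw [Nat.card_eq_fintype_card, ← Nat.cast_inj (R := ℂ)]
    push_cast
    rw [← h1]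
    field_simp
  · intro M hM
    let A : Finset (Fin N) := {i | M i ≠ 1}
    have hA : A.card < d := by
      rw [errorWeight, Set.ncard_eq_toFinset_card'] at hM
      simpa [A, Set.toFinset_ofPred] using hM
    have hMA : ∀ i ∉ A, M i = 1 := fun i hi => by simpa [A] using hi
    let Y : Finset (Fin N → V) :=
      Fintype.piFinset fun i => if i ∈ A then (Finset.univ : Finset V) else {0}
    have hY : (Y.card : ℂ) ≠ 0 := by
      rw [Nat.cast_ne_zero, Finset.card_ne_zero]
      exact ⟨0, by simp only [Y, Fintype.mem_piFinset]; intro i; split_ifs <;> simp⟩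
    -- Each pattern on `A` lifts to a word of `D`. Its letters off `A` are uncontrolled but
    -- harmless: `M` is the identity there and the operators are unitary.
    choose s hsD hs using hres A hA
    refine ⟨(Y.card : ℂ)⁻¹ * ∏ i, if i ∈ A then (l : ℂ) * (M i).trace else 1, ?_, ?_⟩
    · intro h0
      rw [trace_tensorError, Finset.prod_eq_zero_iff] at h0
      obtain ⟨i, -, hi⟩ := h0
      -- Off `A` the factor is the identity, of trace `l ≠ 0`, so a vanishing trace comes from the
      -- support.
      have hiA : i ∈ A := by
        by_contra hiA
        rw [hMA i hiA] at hi
        simp [hl] at hi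
      rw [Finset.prod_eq_zero (Finset.mem_univ i) (by simp [hiA, hi]), mul_zero]
    · intro u hu v hv
      have hfix : ∀ w ∈ LinearMap.range Pl, ∀ x : D, Matrix.toEuclideanLin (T x) w = w := by
        rintro _ ⟨w, rfl⟩ x
        rw [← LinearMap.comp_apply, ← Matrix.toLpLin_mul_same, hTP]
      have hconj : ∀ y : Fin N → V, inner ℂ u (Matrix.toEuclideanLin (tensorError M) v)
          = inner ℂ u (Matrix.toEuclideanLin
            (tensorError fun i => (W.op (y i)).conjTranspose * M i * W.op (y i)) v) := by
        intro y
        have h1 : (T ⟨s y, hsD y⟩).conjTranspose * tensorError M * T ⟨s y, hsD y⟩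
            = tensorError fun i => (W.op (y i)).conjTranspose * M i * W.op (y i) := by
          simp only [T, Matrix.conjTranspose_smul, Matrix.smul_mul, Matrix.mul_smul, smul_smul,
            wordOp, tensorError_conjTranspose, tensorError_mul]
          rw [mul_comm, hε, one_smul]
          congr 1
          funext i
          by_cases hi : i ∈ A
          · rw [hs y i hi]
          · rw [hMA i hi, Matrix.mul_one, Matrix.mul_one, W.conjTranspose_op_mul,
              W.conjTranspose_op_mul]
        rw [← h1, ← inner_toEuclideanLin_conj, hfix u hu, hfix v hv]
      have hsum : (Y.card : ℂ) * inner ℂ u (Matrix.toEuclideanLin (tensorError M) v)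
          = (∏ i, if i ∈ A then (l : ℂ) * (M i).trace else 1) * inner ℂ u v := by
        rw [← nsmul_eq_mul, ← Finset.sum_const, Finset.sum_congr rfl fun y _ => hconj y,
          ← inner_sum, ← LinearMap.sum_apply, ← map_sum, W.sum_conj_wordOp M A hMA, map_smul,
          Matrix.toLpLin_one, LinearMap.smul_apply, LinearMap.id_apply, inner_smul_right]
      rw [mul_assoc, ← hsum, inv_mul_cancel_left₀ hY]

end WeylSystem

/-! ### The Weyl system of a finite field of even square order -/

/-- Shift and phase operators on `ℂ^L` for a finite field `L` of characteristic two, indexed by a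
group `V` identified with `L × L`. -/
noncomputable def WeylSystem.ofFiniteField {L V : Type*} [Field L] [Fintype L] [DecidableEq L]
    [CharP L 2] [Module (ZMod 2) L] [AddCommGroup V] [Module (ZMod 2) V] [Fintype V] {l : ℕ}
    (φ : V ≃ₗ[ZMod 2] L × L) (e : Fin l ≃ L) (τ : L →ₗ[ZMod 2] ZMod 2) (hτ : τ ≠ 0) :
    WeylSystem V l := by
  have hl : (Fintype.card L : ℂ) = l := by
    rw [← Fintype.card_congr e, Fintype.card_fin]
  let ψ : AddChar L ℂ := signChar.compAddMonoidHom τ.toAddMonoidHom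
  have hψ : ∀ x, ψ x = signChar (τ x) := fun _ => rfl
  have hψstar : ∀ x, star (ψ x) = ψ x := fun x => star_signChar _
  have hprim : ψ.IsPrimitive := by
    refine AddChar.IsPrimitive.of_ne_one fun h => hτ (LinearMap.ext fun x => ?_)
    have h1 : signChar (τ x) = 1 := by rw [← hψ, h]; rfl
    have h2 : ∀ z : ZMod 2, z = 0 ∨ z = 1 := by decide
    rcases h2 (τ x) with hx | hx
    · simpa using hx
    · rw [hx, signChar_one] at h1
      norm_num at h1
  -- With φ u = (a, b), this sends the basis vector y to ψ(b y) times the basis vector y + a.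
  let w : V → Matrix L L ℂ := fun u =>
    Matrix.of fun x y => if x = y + (φ u).1 then ψ ((φ u).2 * y) else 0
  have hw_mul : ∀ u v, w u * w v = signChar (τ ((φ u).2 * (φ v).1)) • w (u + v) := by
    intro u v
    ext x z
    simp only [w, Matrix.mul_apply, Matrix.of_apply, Matrix.smul_apply, smul_eq_mul, map_add,
      Prod.fst_add, Prod.snd_add, mul_ite, mul_zero]
    rw [Finset.sum_ite_eq' Finset.univ (z + (φ v).1)]
    simp only [Finset.mem_univ, if_true, ite_mul, zero_mul]
    have : x = z + (φ v).1 + (φ u).1 ↔ x = z + ((φ u).1 + (φ v).1) := by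
      rw [add_assoc, add_comm (φ v).1]
    simp only [this]
    split_ifs
    · rw [← hψ, ← AddChar.map_add_eq_mul, ← AddChar.map_add_eq_mul]
      congr 1
      ring
    · rfl
  have hw_conj : ∀ u (M : Matrix L L ℂ) x z, ((w u).conjTranspose * M * w u) x z
      = ψ ((φ u).2 * (x + z)) * M (x + (φ u).1) (z + (φ u).1) := by
    intro u M x z
    simp only [w, Matrix.mul_apply, Matrix.conjTranspose_apply, Matrix.of_apply, mul_ite, mul_zero]
    rw [Finset.sum_ite_eq' Finset.univ (z + (φ u).1)]
    simp only [Finset.mem_univ, if_true, apply_ite star, star_zero, ite_mul, zero_mul, hψstar]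
    rw [Finset.sum_ite_eq' Finset.univ (x + (φ u).1)]
    simp only [Finset.mem_univ, if_true, mul_add, AddChar.map_add_eq_mul]
    ring
  have hw_zero : w 0 = 1 := by
    ext x y
    simp [w, Matrix.one_apply]
  have hw_trace : ∀ u, u ≠ 0 → (w u).trace = 0 := by
    intro u hu
    simp only [w, Matrix.trace, Matrix.diag_apply, Matrix.of_apply, left_eq_add]
    split_ifs with h
    · have hb : (φ u).2 ≠ 0 := fun hb => hu (φ.map_eq_zero_iff.mp (Prod.ext h hb))
      have := AddChar.sum_mulShift (φ u).2 hprim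
      simp only [if_neg hb, Nat.cast_zero] at this
      simpa only [mul_comm] using this
    · simp
  have hw_unit : ∀ u, (w u).conjTranspose * w u = 1 := by
    intro u
    ext x z
    have := hw_conj u 1 x z
    rw [Matrix.mul_one] at this
    rw [this]
    by_cases h : x = z
    · subst h
      simp [CharTwo.add_self_eq_zero]
    · rw [Matrix.one_apply_ne h, Matrix.one_apply_ne (fun h' => h (add_right_cancel h')), mul_zero]
  -- Summing over the phase b kills the off-diagonal entries by orthogonality of characters; summing
  -- over the shift a turns each diagonal entry into the trace.
  have hw_twirl : ∀ M : Matrix L L ℂ,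
      ∑ u, (w u).conjTranspose * M * w u = ((l : ℂ) * M.trace) • 1 := by
    intro M
    ext x z
    rw [Matrix.sum_apply]
    simp only [hw_conj]
    refine (φ.toEquiv.sum_comp fun p : L × L =>
      ψ (p.2 * (x + z)) * M (x + p.1) (z + p.1)).trans ?_
    rw [Fintype.sum_prod_type]
    simp only [← Finset.sum_mul, AddChar.sum_mulShift _ hprim, CharTwo.add_eq_zero]
    by_cases h : x = z
    · subst h
      simp only [if_true, ← Finset.mul_sum, hl, Matrix.smul_apply, Matrix.one_apply_eq, smul_eq_mul,
        mul_one, Matrix.trace, Matrix.diag_apply]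
      congr 1
      exact Fintype.sum_equiv (Equiv.addLeft x) _ _ fun _ => rfl
    · simp [h]
  exact
    { op := fun u => (w u).submatrix e e
      form := LinearMap.mk₂ (ZMod 2) (fun u v => τ ((φ u).2 * (φ v).1))
        (by intros; simp [add_mul])
        (by
          intro c u v
          have : ∀ z : ZMod 2, z = 0 ∨ z = 1 := by decide
          rcases this c with rfl | rfl <;> simp)
        (by intros; simp [mul_add])
        (by
          intro c u v
          have : ∀ z : ZMod 2, z = 0 ∨ z = 1 := by decide
          rcases this c with rfl | rfl <;> simp)
      op_mul := fun u v => by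
        rw [Matrix.submatrix_mul_equiv, hw_mul]
        rfl
      op_zero := by rw [hw_zero, Matrix.submatrix_one_equiv]
      trace_op := fun u hu => by
        rw [← hw_trace u hu]
        exact e.sum_comp fun x => w u x x
      conjTranspose_op_mul := fun u => by
        rw [Matrix.conjTranspose_submatrix, Matrix.submatrix_mul_equiv, hw_unit,
          Matrix.submatrix_one_equiv]
      twirl := fun M => by
        have hM : M = (M.submatrix e.symm e.symm).submatrix e e := by simp
        have htr : M.trace = (M.submatrix e.symm e.symm).trace :=
          (e.symm.sum_comp fun i => M i i).symm
        have := congrArg (fun B => Matrix.submatrix B e e) (hw_twirl (M.submatrix e.symm e.symm))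
        conv_lhs => rw [hM]
        simp only [Matrix.conjTranspose_submatrix, Matrix.submatrix_mul_equiv]
        rw [htr]
        ext i j
        have := congrFun (congrFun this i) j
        simpa [Matrix.sum_apply, Matrix.one_apply] using this }

lemma WeylSystem.ofFiniteField_form {L V : Type*} [Field L] [Fintype L] [DecidableEq L]
    [CharP L 2] [Module (ZMod 2) L] [AddCommGroup V] [Module (ZMod 2) V] [Fintype V] {l : ℕ}
    (φ : V ≃ₗ[ZMod 2] L × L) (e : Fin l ≃ L) (τ : L →ₗ[ZMod 2] ZMod 2) (hτ : τ ≠ 0) (u v : V) :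
    (WeylSystem.ofFiniteField φ e τ hτ).form u v = τ ((φ u).2 * (φ v).1) := rfl

/-- A field of order `l²`, with `l` a power of two, carries a Weyl system whose commutation form
is a function of the Hermitian product `u vˡ`. -/
theorem exists_weylSystem_hermitian (F : Type*) [Field F] [Fintype F] [CharP F 2]
    [Module (ZMod 2) F] {r l : ℕ} (hr : l = 2 ^ r) (hcard : Fintype.card F = l ^ 2) :
    ∃ (W : WeylSystem F l) (τ : F →+ ZMod 2), ∀ u v, W.form u v - W.form v u = τ (u * v ^ l) := by
  classical
  have hl2 : 2 ≤ l := by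
    have := Fintype.one_lt_card (α := F)
    by_contra! h
    have := Nat.pow_le_pow_left (Nat.le_of_lt_succ h) 2
    omega
  let σ : F →+* F := iterateFrobenius F 2 r
  have hσ : ∀ x, σ x = x ^ l := fun x => by rw [hr]; exact iterateFrobenius_def 2 r x
  have hσσ : ∀ x, σ (σ x) = x := fun x => by
    rw [hσ, hσ, ← pow_mul, ← sq, ← hcard, FiniteField.pow_card]
  -- Otherwise a generator of Fˣ, of order l² - 1, would have order dividing l - 1.
  obtain ⟨θ, hθ⟩ : ∃ θ, σ θ ≠ θ := by
    by_contra! h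
    obtain ⟨g, hg⟩ := IsCyclic.exists_ofOrder_eq_natCard (α := Fˣ)
    have h1 : g ^ (l - 1) = 1 := by
      have h2 : g ^ l = g := Units.ext (by simpa [hσ] using h g)
      rw [← mul_left_inj g, ← pow_succ, Nat.sub_add_cancel (by omega), h2, one_mul]
    have h3 := Nat.le_of_dvd (by omega) (orderOf_dvd_of_pow_eq_one h1)
    rw [hg, Nat.card_eq_fintype_card, Fintype.card_units, hcard] at h3
    have : l * 2 ≤ l ^ 2 := by nlinarith
    omega
  let L : Subfield F := RingHom.eqLocusField σ (RingHom.id F)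
  have hL : ∀ x, x ∈ L ↔ σ x = x := fun _ => Iff.rfl
  let _ : Module (ZMod 2) L := (ZMod.algebra L 2).toModule
  have htwo : ∀ x : F, x + x = 0 := CharTwo.add_self_eq_zero
  set δ := θ + σ θ with hδ_def
  have hδ : δ ≠ 0 := fun h => hθ (CharTwo.add_eq_zero.mp h).symm
  have hδL : δ ∈ L := by rw [hL, hδ_def, map_add, hσσ, add_comm]
  have hνL : θ * σ θ ∈ L := by rw [hL, map_mul, hσσ, mul_comm]
  -- The decomposition F = L ⊕ θL over the fixed field `L` of the involution `σ`.
  let f : L × L →+ F := AddMonoidHom.mk' (fun p => (p.1 : F) + θ * p.2) fun p p' => by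
    simp only [Prod.fst_add, Prod.snd_add, Subfield.coe_add]; ring
  have hf : ∀ p, f p = (p.1 : F) + θ * p.2 := fun _ => rfl
  have hinj : Function.Injective f := by
    rw [injective_iff_map_eq_zero]
    rintro ⟨⟨a, ha⟩, ⟨b, hb⟩⟩ h
    simp only [hf] at h
    have hb0 : b = 0 := by
      have h2 := congrArg σ h
      rw [map_add, map_mul, (hL a).mp ha, (hL b).mp hb, map_zero] at h2
      have h3 : δ * b = 0 := by
        rw [hδ_def]; linear_combination h + h2 - htwo a
      exact (mul_eq_zero.mp h3).resolve_left hδ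
    subst hb0
    have ha0 : a = 0 := by simpa using h
    subst ha0
    rfl
  have hsurj : Function.Surjective f := by
    intro x
    -- If x = a + θ b, then x + σ x = δ b in characteristic two, which determines b.
    have hb : (x + σ x) / δ ∈ L :=
      L.div_mem ((hL _).mpr (by rw [map_add, hσσ, add_comm])) hδL
    have ha : x + θ * ((x + σ x) / δ) ∈ L := by
      rw [hL, map_add, map_mul, (hL _).mp hb]
      have h1 : δ * ((x + σ x) / δ) = x + σ x := mul_div_cancel₀ _ hδ
      rw [hδ_def] at h1 ⊢
      linear_combination h1 + htwo (σ x) - htwo (θ * ((x + σ x) / (θ + σ θ)))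
    refine ⟨(⟨_, ha⟩, ⟨_, hb⟩), ?_⟩
    rw [hf]
    linear_combination htwo (θ * ((x + σ x) / δ))
  let φ : F ≃ₗ[ZMod 2] L × L := (LinearEquiv.ofBijective (f.toZModLinearMap 2) ⟨hinj, hsurj⟩).symm
  have hφ : ∀ x, f (φ x) = x := fun x =>
    (LinearEquiv.ofBijective (f.toZModLinearMap 2) ⟨hinj, hsurj⟩).apply_symm_apply x
  have hφ' : ∀ p, φ (f p) = p := fun p =>
    (LinearEquiv.ofBijective (f.toZModLinearMap 2) ⟨hinj, hsurj⟩).symm_apply_apply p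
  have hcardL : Fintype.card L = l := by
    have h1 := Fintype.card_congr φ.toEquiv
    rw [hcard, Fintype.card_prod, ← sq] at h1
    exact (Nat.pow_left_injective two_ne_zero h1).symm
  let _ : Algebra (ZMod 2) L := ZMod.algebra L 2
  have hτ : Algebra.trace (ZMod 2) L ≠ 0 := Algebra.trace_ne_zero _ _
  refine ⟨WeylSystem.ofFiniteField φ (Fintype.equivFinOfCardEq hcardL).symm _ hτ,
    (Algebra.trace (ZMod 2) L).toAddMonoidHom.comp
      ((AddMonoidHom.snd L L).comp φ.toLinearMap.toAddMonoidHom), fun u v => ?_⟩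
  -- Expand (a + θ b)(a' + σ(θ) b') with σ(θ) = δ - θ: the θ-coordinate is b a' - b' a, the argument
  -- of τ in the commutation form.
  have key : φ (u * v ^ l) = ((φ u).1 * (φ v).1 + ⟨δ, hδL⟩ * (φ u).1 * (φ v).2
      + ⟨θ * σ θ, hνL⟩ * (φ u).2 * (φ v).2, (φ u).2 * (φ v).1 - (φ v).2 * (φ u).1) := by
    rw [← hφ' (_, _)]
    congr 1
    have hu := hφ u
    have hv := hφ v
    rw [hf] at hu hv
    conv_lhs => rw [← hσ, ← hu, ← hv]
    rw [map_add, map_mul, (hL _).mp (φ v).1.2, (hL _).mp (φ v).2.2, hf]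
    simp only [Subfield.coe_add, Subfield.coe_mul, Subfield.coe_sub]
    rw [hδ_def]
    ring
  rw [WeylSystem.ofFiniteField_form, WeylSystem.ofFiniteField_form, ← map_sub]
  change _ = Algebra.trace (ZMod 2) L (φ (u * v ^ l)).2
  rw [key]

/-! ### Cyclotomic cosets -/

section Coset

variable {n q : ℕ}

lemma mem_cyclotomicCoset_self (a : ZMod n) : a ∈ cyclotomicCoset n q a := ⟨0, by simp⟩

lemma cyclotomicCoset_zero : cyclotomicCoset n q 0 = {0} := by
  ext b
  simp [cyclotomicCoset]

lemma exists_pow_mul_pow_eq_one [NeZero n] (h : Nat.Coprime q n) (j : ℕ) :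
    ∃ k, (q : ZMod n) ^ j * (q : ZMod n) ^ k = 1 := by
  have hfin : IsOfFinOrder (q : ZMod n) := by
    rw [← ZMod.coe_unitOfCoprime q h, Units.isOfFinOrder_val]
    exact isOfFinOrder_of_finite _
  obtain ⟨m, hm, hpow⟩ := hfin.exists_pow_eq_one
  refine ⟨j * (m - 1), ?_⟩
  rw [← pow_add, show j + j * (m - 1) = m * j by
    obtain ⟨m, rfl⟩ := Nat.exists_eq_succ_of_ne_zero hm.ne'
    simp; ring, pow_mul, hpow, one_pow]

lemma cyclotomicCoset_mul_pow [NeZero n] (h : Nat.Coprime q n) (a : ZMod n) (j : ℕ) :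
    cyclotomicCoset n q (a * (q : ZMod n) ^ j) = cyclotomicCoset n q a := by
  ext b
  constructor
  · rintro ⟨i, rfl⟩
    exact ⟨j + i, by ring⟩
  · rintro ⟨i, rfl⟩
    obtain ⟨k, hk⟩ := exists_pow_mul_pow_eq_one h j
    exact ⟨k + i, by rw [pow_add, mul_assoc, ← mul_assoc (_ ^ j), hk, one_mul]⟩

/-- The coset is a periodic orbit of multiplication by `q`, so its size is a period to which
iteration lemmas apply. -/
lemma ncard_cyclotomicCoset [NeZero n] (h : Nat.Coprime q n) (a : ZMod n) :
    (cyclotomicCoset n q a).ncard = Function.minimalPeriod (· * (q : ZMod n)) a := by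
  have hpos : 0 < Function.minimalPeriod (· * (q : ZMod n)) a := by
    obtain ⟨k, hk⟩ := exists_pow_mul_pow_eq_one h 1
    refine Function.IsPeriodicPt.minimalPeriod_pos (n := 1 + k) (by omega) ?_
    rw [Function.IsPeriodicPt, Function.IsFixedPt, mul_right_iterate_apply, pow_add, hk, mul_one]
  have himage : cyclotomicCoset n q a = (fun i => (· * (q : ZMod n))^[i] a) ''
      Set.Iio (Function.minimalPeriod (· * (q : ZMod n)) a) := by
    ext b
    constructor
    · rintro ⟨i, rfl⟩
      refine ⟨i % Function.minimalPeriod (· * (q : ZMod n)) a, Nat.mod_lt _ hpos, ?_⟩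
      change (· * (q : ZMod n))^[_] a = _
      rw [Function.iterate_mod_minimalPeriod_eq, mul_right_iterate_apply]
    · rintro ⟨i, -, rfl⟩
      exact ⟨i, mul_right_iterate_apply _ _⟩
  rw [himage, Set.InjOn.ncard_image Function.iterate_injOn_Iio_minimalPeriod, ← Finset.coe_Iio,
    Set.ncard_coe_finset, Nat.card_Iio]

lemma mul_pow_ncard_cyclotomicCoset [NeZero n] (h : Nat.Coprime q n) (a : ZMod n) :
    a * (q : ZMod n) ^ (cyclotomicCoset n q a).ncard = a := by
  rw [ncard_cyclotomicCoset h, ← mul_right_iterate_apply]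
  exact Function.iterate_minimalPeriod

lemma ncard_cyclotomicCoset_dvd [NeZero n] (h : Nat.Coprime q n) (a : ZMod n) :
    (cyclotomicCoset n q a).ncard ∣ orderOf (q : ZMod n) := by
  rw [ncard_cyclotomicCoset h]
  refine Function.IsPeriodicPt.minimalPeriod_dvd ?_
  rw [Function.IsPeriodicPt, Function.IsFixedPt, mul_right_iterate_apply, pow_orderOf_eq_one,
    mul_one]

lemma mem_dualCosets_scaleCosets [NeZero n] (h : Nat.Coprime q n) {l : ℕ}
    {S : Set (Set (ZMod n))} {a b : ZMod n} (ha : cyclotomicCoset n q a ∈ S) {i j : ℕ}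
    (hab : b * (q : ZMod n) ^ i + a * l * (q : ZMod n) ^ j = 0) :
    cyclotomicCoset n q b ∈ dualCosets n q (scaleCosets n q l S) :=
  ⟨a * l * (q : ZMod n) ^ j, b, ⟨a, ha, cyclotomicCoset_mul_pow h _ _⟩, rfl, _, ⟨i, rfl⟩,
    by rw [add_comm, hab]⟩

/-- Powers of `q` are invertible by powers of `q`, so all choices of representatives collapse into
one exponent `k`. -/
lemma exists_of_mem_dualCosets_scaleCosets [NeZero n] (h : Nat.Coprime q n) {l : ℕ}
    {S : Set (Set (ZMod n))} {b : ZMod n}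
    (hb : cyclotomicCoset n q b ∈ dualCosets n q (scaleCosets n q l S)) :
    ∃ a k, cyclotomicCoset n q a ∈ S ∧ -b = a * l * (q : ZMod n) ^ k := by
  obtain ⟨a₀, b', ⟨a, ha, haa⟩, hbb, c, hc, hac⟩ := hb
  obtain ⟨e, he⟩ : a₀ ∈ cyclotomicCoset n q (a * l) := haa ▸ mem_cyclotomicCoset_self a₀
  obtain ⟨j, hj⟩ : c ∈ cyclotomicCoset n q b := hbb ▸ hc
  obtain ⟨k, hk⟩ := exists_pow_mul_pow_eq_one h j
  refine ⟨a, e + k, ha, ?_⟩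
  subst he hj
  rw [pow_add]
  linear_combination (-(q : ZMod n) ^ k) * hac + b * hk

end Coset

/-! ### Block sums and the Vandermonde argument. -/

lemma sum_range_mul {M : Type*} [AddCommMonoid M] (f : ℕ → M) (s t : ℕ) :
    ∑ k ∈ Finset.range (s * t), f k
      = ∑ j ∈ Finset.range t, ∑ i ∈ Finset.range s, f (s * j + i) := by
  induction t with
  | zero => simp
  | succ t ih => rw [Nat.mul_succ, Finset.sum_range_add, ih, Finset.sum_range_succ]

/-- A vector orthogonal to all powers of exponent less than its weight of a family of distinct
points vanishes. -/
lemma eq_zero_of_forall_sum_mul_pow_eq_zero {ι K : Type*} [Fintype ι] [Field K] [DecidableEq K]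
    {x : ι → K} (hx : Function.Injective x) {v : ι → K}
    (h : ∀ j < Finset.card {i | v i ≠ 0}, ∑ i, v i * x i ^ j = 0) : v = 0 := by
  classical
  by_contra hv
  obtain ⟨i₀, hi₀⟩ := Function.ne_iff.mp hv
  set A : Finset ι := {i | v i ≠ 0} with hA
  have hmem : i₀ ∈ A := by simpa [hA] using hi₀
  -- Vanishes on the support except at `x i₀`, with degree below the weight, so pairing it with `v`
  -- isolates the entry at `i₀`.
  let p : K[X] := ∏ i ∈ A.erase i₀, (X - C (x i))
  have hdeg : p.natDegree < A.card := by
    rw [natDegree_prod_of_monic _ _ fun i _ => monic_X_sub_C _]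
    simp only [natDegree_X_sub_C, Finset.sum_const, smul_eq_mul, mul_one]
    exact Finset.card_erase_lt_of_mem hmem
  have h0 : ∑ i, v i * p.eval (x i) = 0 := by
    simp only [eval_eq_sum_range' hdeg, Finset.mul_sum]
    rw [Finset.sum_comm]
    refine Finset.sum_eq_zero fun j hj => ?_
    have := h j (Finset.mem_range.mp hj)
    calc _ = p.coeff j * ∑ i, v i * x i ^ j := by
          rw [Finset.mul_sum]
          exact Finset.sum_congr rfl fun i _ => by ring
      _ = 0 := by rw [this, mul_zero]
  rw [Finset.sum_eq_single i₀] at h0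
  · rcases mul_eq_zero.mp h0 with h1 | h1
    · exact hi₀ h1
    · rw [eval_prod, Finset.prod_eq_zero_iff] at h1
      obtain ⟨i, hi, hi'⟩ := h1
      simp only [eval_sub, eval_X, eval_C, sub_eq_zero] at hi'
      exact (Finset.mem_erase.mp hi).1 (hx hi').symm
  · intro i _ hi
    by_cases hvi : v i = 0
    · rw [hvi, zero_mul]
    · have : i ∈ A.erase i₀ := Finset.mem_erase.mpr ⟨hi, by simpa [hA] using hvi⟩
      rw [eval_prod, Finset.prod_eq_zero this (by simp), mul_zero]
  · simp

/-! ### Evaluation points -/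

section Points

variable {K : Type*} [Field K] {n : ℕ}

lemma card_evalPoint [Fintype (EvalPoint K n)] {ζ : K} (hn : 0 < n) (hζ : IsPrimitiveRoot ζ n) :
    Fintype.card (EvalPoint K n) = n + 1 := by
  classical
  have h0 : (0 : K) ∉ nthRootsFinset n (1 : K) := by
    simp [mem_nthRootsFinset hn, zero_pow hn.ne']
  rw [Fintype.card_of_subtype (insert 0 (nthRootsFinset n (1 : K))), Finset.card_insert_of_notMem h0,
    hζ.card_nthRootsFinset]
  intro x
  rw [Finset.mem_insert, mem_nthRootsFinset hn, or_comm]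

/-- Multiplication by `ζ` permutes the points, fixing 0, and scales the sum by `ζ ^ k ≠ 1`. -/
lemma sum_evalPoint_pow [Fintype (EvalPoint K n)] {ζ : K} (hn : 0 < n) (hζ : IsPrimitiveRoot ζ n)
    {k : ℕ} (hk : ¬ n ∣ k) : ∑ β : EvalPoint K n, (β : K) ^ k = 0 := by
  have hζ0 : ζ ≠ 0 := hζ.ne_zero hn.ne'
  let e : EvalPoint K n ≃ EvalPoint K n := (Equiv.mulLeft₀ ζ hζ0).subtypeEquiv fun β => by
    simp [mul_pow, hζ.pow_eq_one, hζ0]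
  have h1 : ∑ β : EvalPoint K n, (β : K) ^ k = ζ ^ k * ∑ β : EvalPoint K n, (β : K) ^ k := by
    conv_lhs => rw [← e.sum_comp]
    rw [Finset.mul_sum]
    exact Finset.sum_congr rfl fun β _ => mul_pow ζ (β : K) k
  have h2 : ζ ^ k ≠ 1 := fun h => hk (hζ.dvd_of_pow_eq_one k h)
  have h3 : (ζ ^ k - 1) * ∑ β : EvalPoint K n, (β : K) ^ k = 0 := by linear_combination -h1
  exact (mul_eq_zero.mp h3).resolve_left (sub_ne_zero.mpr h2)

lemma pow_eq_pow_of_natCast_eq {β : K} (hβ : β ^ n = 1) {i j : ℕ} (h : (i : ZMod n) = j) :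
    β ^ i = β ^ j := by
  rw [ZMod.natCast_eq_natCast_iff] at h
  rw [← pow_mod_orderOf β i, ← pow_mod_orderOf β j, h.of_dvd (orderOf_dvd_of_pow_eq_one hβ)]

/-- On the evaluation points x^a takes values in the subfield of order q^{s_a}, since a q^{s_a} = a
modulo n. -/
lemma evalPoint_pow_pow [NeZero n] {q : ℕ} (h : Nat.Coprime q n) (hq : q ≠ 0) (a : ZMod n)
    (β : EvalPoint K n) :
    ((β : K) ^ a.val) ^ q ^ (cyclotomicCoset n q a).ncard = (β : K) ^ a.val := by
  obtain ⟨β, hβ | rfl⟩ := β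
  · rw [← pow_mul]
    refine pow_eq_pow_of_natCast_eq hβ ?_
    push_cast
    rw [ZMod.natCast_zmod_val, mul_pow_ncard_cyclotomicCoset h]
  · by_cases ha : a.val = 0
    · simp [ha]
    · simp [ha, zero_pow, hq]

lemma exists_isPrimitiveRoot [Finite K] (h : n ∣ Nat.card K - 1) :
    ∃ ζ : K, IsPrimitiveRoot ζ n := by
  obtain ⟨g, hg⟩ := IsCyclic.exists_ofOrder_eq_natCard (α := Kˣ)
  rw [Nat.card_units] at hg
  obtain ⟨t, ht⟩ := h
  have hpos : 0 < Nat.card K - 1 := Nat.sub_pos_of_lt Finite.one_lt_card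
  refine ⟨((g ^ t : Kˣ) : K), IsPrimitiveRoot.coe_units_iff.mpr ?_⟩
  refine (IsPrimitiveRoot.orderOf g).pow (hg ▸ hpos) ?_
  rw [hg, ht, mul_comm]

end Points

/-! ### The classical code -/

section ClassicalCode

variable {F K : Type*} [Field F] [Field K] [Algebra F K] {n q : ℕ}

/-- The words `β ↦ Tr(x βᵃ)` belong to the code. -/
lemma trace_word_mem_cosetCode [NeZero n] [Finite F] [CharP K 2] (h : Nat.Coprime q n) {e : ℕ}
    (hqe : q = 2 ^ e) (hF : Nat.card F = q) [Finite K]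
    (hK : Module.finrank F K = orderOf (q : ZMod n)) {S : Set (Set (ZMod n))} {a : ZMod n}
    (ha : cyclotomicCoset n q a ∈ S) (x : K) :
    (fun β : EvalPoint K n => Algebra.trace F K (x * (β : K) ^ a.val)) ∈ cosetCode F K n q S := by
  have hq0 : q ≠ 0 := by rw [hqe]; positivity
  set s := (cyclotomicCoset n q a).ncard with hs
  obtain ⟨t, ht⟩ := ncard_cyclotomicCoset_dvd h a
  rw [← hK, ← hs] at ht
  have hsum : ∀ (i : ℕ) (A : Finset ℕ) (g : ℕ → K),
      (∑ j ∈ A, g j) ^ q ^ i = ∑ j ∈ A, g j ^ q ^ i := by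
    intro i A g
    rw [hqe, ← pow_mul]
    exact sum_pow_char_pow 2 _ _ _
  have hxcard : x ^ q ^ (s * t) = x := by
    have := Fintype.ofFinite K
    have := Fintype.ofFinite F
    rw [← ht, ← hF, Nat.card_eq_fintype_card, ← Module.card_eq_pow_finrank, FiniteField.pow_card]
  -- The relative trace of `x` to the subfield of order q^s; the word is then the value of the
  -- generator with coefficient `γ`, by transitivity of the trace.
  let γ : K := ∑ j ∈ Finset.range t, x ^ q ^ (s * j)
  have hγ : γ ^ q ^ s = γ := by
    have hstep : ∀ j, (x ^ q ^ (s * j)) ^ q ^ s = x ^ q ^ (s * (j + 1)) := fun j => by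
      rw [← pow_mul, ← pow_add, Nat.mul_succ]
    have h1 : γ + x ^ q ^ (s * t) = γ ^ q ^ s + x ^ q ^ (s * 0) := by
      rw [hsum, Finset.sum_congr rfl fun j _ => hstep j, ← Finset.sum_range_succ,
        ← Finset.sum_range_succ' fun j => x ^ q ^ (s * j)]
    rw [hxcard, mul_zero, pow_zero, pow_one] at h1
    exact (add_right_cancel h1).symm
  refine ⟨cosetPoly n q a γ, Submodule.subset_span ⟨a, γ, ha, hγ, rfl⟩, fun β => ?_⟩
  have hy : ((β : K) ^ a.val) ^ q ^ s = (β : K) ^ a.val := evalPoint_pow_pow h hq0 a β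
  have hyj : ∀ j, ((β : K) ^ a.val) ^ q ^ (s * j) = (β : K) ^ a.val := by
    intro j
    induction j with
    | zero => simp
    | succ j ih => rw [Nat.mul_succ, pow_add, pow_mul, ih, hy]
  rw [FiniteField.algebraMap_trace_eq_sum_pow, hF, ht, sum_range_mul, Finset.sum_comm, cosetPoly,
    eval_finsetSum]
  refine Finset.sum_congr rfl fun i _ => ?_
  simp only [eval_pow, eval_mul, eval_C, eval_X]
  rw [Finset.sum_mul, hsum]
  refine Finset.sum_congr rfl fun j _ => ?_
  rw [pow_add, pow_mul, mul_pow _ _ (q ^ (s * j)), hyj]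

/-- Words orthogonal to the code have vanishing Fourier coefficients at the cosets in `S`. -/
lemma sum_mul_pow_eq_zero_of_orthogonal [NeZero n] [Finite F] [CharP K 2] (h : Nat.Coprime q n) {e : ℕ}
    (hqe : q = 2 ^ e) (hF : Nat.card F = q) [Finite K] [Fintype (EvalPoint K n)]
    (hK : Module.finrank F K = orderOf (q : ZMod n)) {S : Set (Set (ZMod n))}
    {w : EvalPoint K n → F} (hw : ∀ c ∈ cosetCode F K n q S, ∑ β, w β * c β = 0)
    {a : ZMod n} (ha : cyclotomicCoset n q a ∈ S) :
    ∑ β, algebraMap F K (w β) * (β : K) ^ a.val = 0 := by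
  set Z := ∑ β, algebraMap F K (w β) * (β : K) ^ a.val with hZ
  by_contra hZ0
  obtain ⟨y, hy⟩ := Algebra.trace_surjective F K 1
  -- With Tr y = 1 and coefficient y / Z, the pairing equals Tr y.
  have h1 := hw _ (trace_word_mem_cosetCode h hqe hF hK ha (y / Z))
  have h2 : Algebra.trace F K (y / Z * Z) = 0 := by
    rw [hZ, Finset.mul_sum, map_sum, ← hZ, ← h1]
    refine Finset.sum_congr rfl fun β _ => ?_
    rw [← smul_eq_mul (w β), ← map_smul, Algebra.smul_def]
    congr 1
    ring
  rw [div_mul_cancel₀ _ hZ0, hy] at h2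
  exact one_ne_zero h2

/-- The sum over the evaluation points of the products of values of two generators. -/
lemma sum_eval_cosetPoly_mul_pow [NeZero n] [CharP K 2] [Fintype (EvalPoint K n)] {l r : ℕ}
    (hl : l = 2 ^ r) {ζ : K} (hζ : IsPrimitiveRoot ζ n) (hodd : Odd n) {a a' : ZMod n}
    (hab : ∀ i j, a * (q : ZMod n) ^ i + a' * l * (q : ZMod n) ^ j = 0 → a = 0 ∧ a' = 0)
    {γ γ' : K} :
    ∑ β : EvalPoint K n, (cosetPoly n q a γ).eval (β : K) * (cosetPoly n q a' γ').eval (β : K) ^ l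
      = 0 := by
  have hn : 0 < n := NeZero.pos n
  have hterm : ∀ i j, ∑ β : EvalPoint K n, (β : K) ^ (a.val * q ^ i + a'.val * l * q ^ j) = 0 := by
    intro i j
    by_cases hdvd : n ∣ a.val * q ^ i + a'.val * l * q ^ j
    · rw [← ZMod.natCast_eq_zero_iff] at hdvd
      push_cast at hdvd
      rw [ZMod.natCast_zmod_val, ZMod.natCast_zmod_val] at hdvd
      -- The exponent is now literally 0, so the point 0 also contributes 1, and the total n + 1 is
      -- even.
      obtain ⟨rfl, rfl⟩ := hab i j hdvd
      simp only [ZMod.val_zero, zero_mul, add_zero, pow_zero, Finset.sum_const, Finset.card_univ,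
        nsmul_eq_mul, mul_one]
      rw [card_evalPoint hn hζ, CharP.cast_eq_zero_iff K 2]
      exact hodd.add_one.two_dvd
    · exact sum_evalPoint_pow hn hζ hdvd
  have heval : ∀ β : EvalPoint K n,
      (cosetPoly n q a γ).eval (β : K) * (cosetPoly n q a' γ').eval (β : K) ^ l
        = ∑ i ∈ Finset.range (cyclotomicCoset n q a).ncard,
          ∑ j ∈ Finset.range (cyclotomicCoset n q a').ncard, γ ^ q ^ i * (γ' ^ q ^ j) ^ l *
            (β : K) ^ (a.val * q ^ i + a'.val * l * q ^ j) := by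
    intro β
    simp only [cosetPoly, eval_finsetSum, eval_pow, eval_mul, eval_C, eval_X]
    have : ∀ (A : Finset ℕ) (g : ℕ → K), (∑ j ∈ A, g j) ^ l = ∑ j ∈ A, g j ^ l := by
      intro A g
      rw [hl]
      exact sum_pow_char_pow 2 _ _ _
    rw [this, Finset.sum_mul_sum]
    refine Finset.sum_congr rfl fun i _ => Finset.sum_congr rfl fun j _ => ?_
    rw [mul_pow, mul_pow, mul_pow, pow_add, ← pow_mul (β : K), ← pow_mul (β : K), ← pow_mul (β : K),
      show a'.val * q ^ j * l = a'.val * l * q ^ j by ring]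
    ring
  simp only [heval]
  rw [Finset.sum_comm]
  refine Finset.sum_eq_zero fun i _ => ?_
  rw [Finset.sum_comm]
  refine Finset.sum_eq_zero fun j _ => ?_
  rw [← Finset.mul_sum, hterm, mul_zero]

/-- Hermitian self-orthogonality of the code. -/
lemma cosetCode_self_orthogonal [NeZero n] [CharP K 2] [Fintype (EvalPoint K n)] {l r : ℕ}
    (hl : l = 2 ^ r) {ζ : K} (hζ : IsPrimitiveRoot ζ n) (hodd : Odd n) {S : Set (Set (ZMod n))}
    (hS : ∀ a a' : ZMod n, cyclotomicCoset n q a ∈ S → cyclotomicCoset n q a' ∈ S → ∀ i j,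
      a * (q : ZMod n) ^ i + a' * l * (q : ZMod n) ^ j = 0 → a = 0 ∧ a' = 0)
    {c c' : EvalPoint K n → F} (hc : c ∈ cosetCode F K n q S) (hc' : c' ∈ cosetCode F K n q S) :
    ∑ β, c β * c' β ^ l = 0 := by
  obtain ⟨f, hf, hcf⟩ := hc
  obtain ⟨g, hg, hcg⟩ := hc'
  apply (algebraMap F K).injective
  simp only [map_sum, map_mul, map_pow, map_zero, hcf, hcg]
  clear hcf hcg c c'
  induction hf using Submodule.span_induction with
  | zero => simp
  | add f₁ f₂ _ _ h₁ h₂ => simp [add_mul, Finset.sum_add_distrib, h₁, h₂]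
  | smul b f _ h => simp only [eval_smul, smul_mul_assoc, ← Finset.smul_sum, h, smul_zero]
  | mem f hf =>
    obtain ⟨a, γ, ha, -, rfl⟩ := hf
    induction hg using Submodule.span_induction with
    | zero =>
      have : l ≠ 0 := by rw [hl]; positivity
      simp [this]
    | add g₁ g₂ _ _ h₁ h₂ =>
      have : ∀ x y : K, (x + y) ^ l = x ^ l + y ^ l := by
        rw [hl]; exact fun x y => add_pow_char_pow x y 2 r
      simp [this, mul_add, Finset.sum_add_distrib, h₁, h₂]
    | smul b g _ h =>
      simp only [eval_smul, _root_.smul_pow, mul_smul_comm, ← Finset.smul_sum, h, smul_zero]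
    | mem g hg =>
      obtain ⟨a', γ', ha', -, rfl⟩ := hg
      exact sum_eval_cosetPoly_mul_pow hl hζ hodd (hS a a' ha ha')

/-- A nonzero word orthogonal to the code has weight at least `d`, if `d` lies within the designed
range and the negatives of `1, …, d - 2` belong to the duals of the cosets `l S`. -/
lemma eq_zero_of_orthogonal_of_card_lt [NeZero n] [Finite F] [CharP K 2] (h : Nat.Coprime q n)
    {l r d : ℕ}
    (hl : l = 2 ^ r) (hq : q = l ^ 2) (hF : Nat.card F = q) [Finite K] [Fintype (EvalPoint K n)]
    (hK : Module.finrank F K = orderOf (q : ZMod n)) {S : Set (Set (ZMod n))} (hS0 : {0} ∈ S)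
    (hdn : d ≤ n + 1)
    (hd : ∀ j : ℕ, 0 < j → j + 2 ≤ d → ∃ a k, cyclotomicCoset n q a ∈ S ∧
      (j : ZMod n) = a * l * (q : ZMod n) ^ k)
    {w : EvalPoint K n → F} (hw : ∀ c ∈ cosetCode F K n q S, ∑ β, w β * c β = 0)
    (hwd : {β | w β ≠ 0}.ncard < d) : w = 0 := by
  classical
  have hl0 : l ≠ 0 := by rw [hl]; positivity
  have hqe : q = 2 ^ (r * 2) := by rw [hq, hl, pow_mul]
  have hcoeff : ∀ {a : ZMod n}, cyclotomicCoset n q a ∈ S →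
      ∑ β, algebraMap F K (w β) * (β : K) ^ a.val = 0 :=
    fun ha => sum_mul_pow_eq_zero_of_orthogonal h hqe hF hK hw ha
  have hsum : ∀ (k : ℕ) (g : EvalPoint K n → K), (∑ β, g β) ^ (l * q ^ k)
      = ∑ β, g β ^ (l * q ^ k) := by
    intro k g
    rw [hl, hqe, ← pow_mul, ← pow_add]
    exact sum_pow_char_pow 2 _ _ _
  have hwq : ∀ β k, algebraMap F K (w β) ^ (l * q ^ k) = algebraMap F K (w β) ^ l := by
    intro β k
    have := Fintype.ofFinite F
    rw [mul_comm, pow_mul, ← map_pow, ← hF, Nat.card_eq_fintype_card, FiniteField.pow_card_pow]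
  -- The l-th power has the same support as `w`, and its moments are those reached by Frobenius.
  have hv : (fun β => algebraMap F K (w β) ^ l) = 0 := by
    refine eq_zero_of_forall_sum_mul_pow_eq_zero (x := fun β : EvalPoint K n => (β : K))
      Subtype.val_injective fun j hj => ?_
    have hjd : j + 2 ≤ d := by
      have : Finset.card {β : EvalPoint K n | algebraMap F K (w β) ^ l ≠ 0}
          = {β | w β ≠ 0}.ncard := by
        rw [Set.ncard_eq_toFinset_card']
        congr 1
        ext β
        simp [hl0]
      omega
    have hpowsum : ∀ {a : ZMod n} {k : ℕ}, cyclotomicCoset n q a ∈ S →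
        ∑ β : EvalPoint K n, algebraMap F K (w β) ^ l * (β : K) ^ (a.val * (l * q ^ k)) = 0 := by
      intro a k ha
      have h1 := congrArg (· ^ (l * q ^ k)) (hcoeff ha)
      simp only [hsum, mul_pow, hwq, ← pow_mul] at h1
      rw [h1, zero_pow]
      rw [hq]
      positivity
    rcases Nat.eq_zero_or_pos j with rfl | hj0
    · have := hpowsum (a := 0) (k := 0) (by rwa [cyclotomicCoset_zero])
      simpa using this
    · obtain ⟨a, k, ha, hak⟩ := hd j hj0 hjd
      refine Eq.trans ?_ (hpowsum (k := k) ha)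
      refine Finset.sum_congr rfl fun β _ => ?_
      congr 1
      obtain ⟨β, hβ | rfl⟩ := β
      · refine pow_eq_pow_of_natCast_eq hβ ?_
        push_cast
        rw [ZMod.natCast_zmod_val, hak, mul_assoc]
      -- At the point 0 congruent exponents agree only if both are positive. This needs j < n, hence
      -- the bound `d ≤ n + 1`.
      · have ha0 : a ≠ 0 := by
          rintro rfl
          rw [zero_mul, zero_mul, ZMod.natCast_eq_zero_iff] at hak
          have := Nat.le_of_dvd hj0 hak
          omega
        have hq0 : q ≠ 0 := by rw [hq]; positivity
        have : a.val * (l * q ^ k) ≠ 0 := by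
          have := (ZMod.val_ne_zero a).mpr ha0
          positivity
        rw [zero_pow hj0.ne', zero_pow this]
  funext β
  simpa [hl0] using congrFun hv β

end ClassicalCode

/-! ### The Hermitian construction. -/

/-- If no nonzero word supported on a finset `A` is orthogonal to a linear code, then the code
restricts onto the space of all words on `A`. -/
lemma exists_mem_forall_eq_of_orthogonal {ι F : Type*} [Fintype ι] [Field F]
    (C : Submodule F (ι → F)) (A : Finset ι)
    (h : ∀ w : ι → F, (∀ i ∉ A, w i = 0) → (∀ c ∈ C, ∑ i, w i * c i = 0) → w = 0) (y : ι → F) :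
    ∃ c ∈ C, ∀ i ∈ A, c i = y i := by
  classical
  let R : (ι → F) →ₗ[F] (A → F) := LinearMap.funLeft F F Subtype.val
  have htop : C.map R = ⊤ := by
    by_contra hne
    obtain ⟨φ, hφ, hle⟩ := Submodule.exists_le_ker_of_lt_top _ (lt_top_iff_ne_top.mpr hne)
    apply hφ
    -- A functional killing the restriction of `C`, extended by zero, is a word orthogonal to `C`
    -- and supported on `A`.
    let w : ι → F := fun i => if hi : i ∈ A then φ (Pi.single ⟨i, hi⟩ 1) else 0
    have hwA : ∀ i : A, w i = φ (Pi.single i 1) := fun i => by simp [w]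
    have hφw : ∀ c : ι → F, φ (R c) = ∑ i, w i * c i := by
      intro c
      rw [LinearMap.pi_apply_eq_sum_univ φ (R c), ← Finset.sum_subset (Finset.subset_univ A)
        fun i _ hi => by simp [w, hi], ← Finset.sum_coe_sort A]
      refine Finset.sum_congr rfl fun i _ => ?_
      rw [hwA, smul_eq_mul, mul_comm]
      congr 2
      ext j
      simp [Pi.single_apply, eq_comm]
    have hw0 := h w (fun i hi => by simp [w, hi]) fun c hc => by
      rw [← hφw]
      exact hle (Submodule.mem_map_of_mem hc)
    refine LinearMap.pi_ext' fun i => LinearMap.ext_ring ?_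
    simpa [hw0] using (hwA i).symm
  obtain ⟨c, hc, hcy⟩ : R y ∈ C.map R := htop ▸ Submodule.mem_top
  exact ⟨c, hc, fun i hi => congrFun hcy ⟨i, hi⟩⟩

/-- The Hermitian construction of quantum codes in even characteristic: a linear code over the
field with `l²` elements which is self-orthogonal for the Hermitian form and whose dual has no
nonzero words of weight less than `d` yields a pure `l`-ary quantum code. -/
theorem exists_quantumCode_of_hermitian {F ι : Type*} [Field F] [Finite F] [CharP F 2] [Fintype ι]
    {l r N d : ℕ} (hl : l = 2 ^ r) (hF : Nat.card F = l ^ 2) (hι : Fintype.card ι = N)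
    (C : Submodule F (ι → F)) (hself : ∀ c ∈ C, ∀ c' ∈ C, ∑ i, c i * c' i ^ l = 0)
    (hdist : ∀ w : ι → F, (∀ c ∈ C, ∑ i, w i * c i = 0) → {i | w i ≠ 0}.ncard < d → w = 0) :
    2 * Module.finrank F C ≤ N ∧
      ∃ Q : Submodule ℂ (QuditSpace l N), IsQuantumCode l N (N - 2 * Module.finrank F C) d Q := by
  classical
  have := Fintype.ofFinite F
  let _ : Algebra (ZMod 2) F := ZMod.algebra F 2
  have hl1 : 1 < l := by
    have := Finite.one_lt_card (α := F)
    by_contra! h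
    have := Nat.pow_le_pow_left h 2
    omega
  obtain ⟨W, τ, hτ⟩ := exists_weylSystem_hermitian F hl (by rw [← hF, Nat.card_eq_fintype_card])
  let e : ι ≃ Fin N := Fintype.equivFinOfCardEq hι
  let D : Submodule F (Fin N → F) := C.comap (LinearMap.funLeft F F e)
  have hcard : Nat.card (D.restrictScalars (ZMod 2)) = l ^ (2 * Module.finrank F C) := by
    have h1 : Nat.card (D.restrictScalars (ZMod 2)) = Nat.card C :=
      Nat.card_congr ((LinearEquiv.funCongrLeft F F e).toEquiv.subtypeEquiv fun _ => Iff.rfl)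
    rw [h1, Module.natCard_eq_pow_finrank (K := F), hF, ← pow_mul]
  have hsymm : ∀ u ∈ D.restrictScalars (ZMod 2), ∀ v ∈ D.restrictScalars (ZMod 2),
      W.wordForm N u v = W.wordForm N v u := by
    intro u hu v hv
    rw [← sub_eq_zero, W.wordForm_apply, W.wordForm_apply, ← Finset.sum_sub_distrib]
    simp only [hτ]
    rw [← map_sum, ← e.sum_comp]
    exact (congrArg τ (hself _ hu _ hv)).trans (map_zero τ)
  have hres : ∀ A : Finset (Fin N), A.card < d → ∀ y : Fin N → F,
      ∃ u ∈ D.restrictScalars (ZMod 2), ∀ i ∈ A, u i = y i := by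
    intro A hA y
    obtain ⟨c, hc, hcy⟩ := exists_mem_forall_eq_of_orthogonal C (A.map e.symm.toEmbedding)
      (fun w hwA hw => hdist w hw <| by
        refine lt_of_le_of_lt (Set.ncard_le_ncard (t := (A.map e.symm.toEmbedding : Set ι)) ?_) ?_
        · intro i hi
          by_contra hiA
          exact hi (hwA i hiA)
        · rwa [Set.ncard_coe_finset, Finset.card_map]) (y ∘ e)
    refine ⟨c ∘ e.symm, ?_, fun i hi => ?_⟩
    · change (c ∘ e.symm) ∘ e ∈ C
      rwa [Function.comp_assoc, Equiv.symm_comp_self, Function.comp_id]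
    · have := hcy (e.symm i) (Finset.mem_map_of_mem _ hi)
      simpa using this
  obtain ⟨Q, hQ, hdet⟩ := W.exists_stabilizer_code (by omega) _ d hsymm hres
  rw [hcard] at hQ
  -- The dimension count shows that l^(2k) divides l^N, with l > 1.
  have hk : 2 * Module.finrank F C ≤ N :=
    (Nat.pow_dvd_pow_iff_le_right hl1).mp (Dvd.intro_left _ hQ)
  refine ⟨hk, Q, ?_, fun M hM => ?_, fun _ M hM htr u hu v hv => ?_⟩
  · have hpos : 0 < l ^ (2 * Module.finrank F C) := by positivity
    refine Nat.eq_of_mul_eq_mul_right hpos ?_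
    rw [hQ, ← pow_add, Nat.sub_add_cancel hk]
  · obtain ⟨c, -, hc⟩ := hdet M hM
    exact ⟨c, hc⟩
  · obtain ⟨c, hc0, hc⟩ := hdet M hM
    rw [hc u hu v hv, hc0 htr, zero_mul]

/-! ### Verification of the hypotheses for the coset code. -/

theorem theorem5p1
    (l q n d : ℕ) (hq : q = l ^ 2) (hq_even : Even q)
    (hn : 1 < n) (hqn : Nat.Coprime q n)
    {F K : Type*} [Field F] [Finite F] [Field K] [Algebra F K]
    (hF : Nat.card F = q)
    (hK : Module.finrank F K = orderOf (q : ZMod n))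
    (S : Set (Set (ZMod n))) (hS : S ⊆ allCosets n q)
    (hS_zero : {0} ∈ S)
    (hd : ∀ a : ℕ, n + 2 ≤ a + d → a ≤ n - 1 →
      cyclotomicCoset n q (a : ZMod n) ∈ dualCosets n q (scaleCosets n q l S))
    (hST : S ⊆ hermitianDualCosets n q l S) :
    2 * Module.finrank F (cosetCode F K n q S) ≤ n + 1 ∧
    ∃ Q : Submodule ℂ (QuditSpace l (n + 1)),
      IsQuantumCode l (n + 1) (n + 1 - 2 * Module.finrank F (cosetCode F K n q S)) d Q := by
  classical
  have : NeZero n := ⟨by omega⟩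
  have : Fact (1 < n) := ⟨hn⟩
  have := Fintype.ofFinite F
  obtain ⟨p, hp⟩ := CharP.exists F
  obtain ⟨e, hpp, hpe⟩ := FiniteField.card F p
  rw [← Nat.card_eq_fintype_card, hF] at hpe
  obtain rfl : p = 2 := by
    rw [hpe, Nat.even_pow] at hq_even
    exact (hpp.even_iff).mp hq_even.1
  obtain ⟨r, -, hl⟩ := (Nat.dvd_prime_pow Nat.prime_two).mp
    (show l ∣ 2 ^ (e : ℕ) by rw [← hpe, hq, sq]; exact dvd_mul_left _ _)
  have hodd : Odd n := by
    rw [← Nat.coprime_two_left]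
    exact hqn.coprime_dvd_left (even_iff_two_dvd.mp hq_even)
  have hln : Nat.Coprime l n := hqn.coprime_dvd_left (by rw [hq, sq]; exact dvd_mul_left _ _)
  have hlunit : IsUnit (l : ZMod n) := (ZMod.unitOfCoprime l hln).isUnit
  have hqunit : IsUnit (q : ZMod n) := (ZMod.unitOfCoprime q hqn).isUnit
  have : CharP K 2 := charP_of_injective_algebraMap (algebraMap F K).injective 2
  have hord : 0 < orderOf (q : ZMod n) := by
    obtain ⟨k, hk⟩ := exists_pow_mul_pow_eq_one hqn 1
    rw [orderOf_pos_iff, isOfFinOrder_iff_pow_eq_one]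
    exact ⟨1 + k, by omega, by rw [pow_add, hk]⟩
  have : FiniteDimensional F K := FiniteDimensional.of_finrank_pos (hK ▸ hord)
  have : Finite K := Module.finite_of_finite F
  have := Fintype.ofFinite (EvalPoint K n)
  obtain ⟨ζ, hζ⟩ : ∃ ζ : K, IsPrimitiveRoot ζ n := by
    refine exists_isPrimitiveRoot ?_
    rw [Module.natCard_eq_pow_finrank (K := F), hF, hK]
    refine (Nat.modEq_iff_dvd' (Nat.one_le_pow _ _ (by rw [hpe]; positivity))).mp ?_
    rw [← ZMod.natCast_eq_natCast_iff]
    push_cast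
    exact (pow_orderOf_eq_one _).symm
  -- By 𝒮 ⊆ 𝒯, the only coset that 𝒮 can share with (l𝒮)* is {0}.
  have hzero : ∀ a : ZMod n, cyclotomicCoset n q a ∈ S →
      cyclotomicCoset n q a ∈ dualCosets n q (scaleCosets n q l S) → a = 0 := by
    intro a ha ha'
    rcases hST ha with h | h
    · have := mem_cyclotomicCoset_self (q := q) a
      rwa [Set.mem_singleton_iff.mp h] at this
    · exact absurd ha' h.2
  refine exists_quantumCode_of_hermitian hl (hF.trans hq) (card_evalPoint (by omega) hζ)
    (cosetCode F K n q S) (fun c hc c' hc' => ?_) fun w hw hwd => ?_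
  · refine cosetCode_self_orthogonal hl hζ hodd (fun a a' ha ha' i j hij => ?_) hc hc'
    obtain rfl := hzero a ha (mem_dualCosets_scaleCosets hqn ha' hij)
    rw [zero_mul, zero_add] at hij
    exact ⟨rfl, (hlunit.mul_left_eq_zero).mp (((hqunit.pow j).mul_left_eq_zero).mp hij)⟩
  -- If d ≥ n + 2, then (l𝒮)* contains all cosets, so 𝒮 contains only {0}, and hence so does (l𝒮)*;
  -- this excludes S_1, as n > 1.
  · have hdn : d ≤ n + 1 := by
      by_contra! hlt
      have hall : ∀ a : ZMod n, cyclotomicCoset n q a ∈ dualCosets n q (scaleCosets n q l S) := by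
        intro a
        have := hd a.val (by omega) (Nat.le_sub_one_of_lt a.val_lt)
        rwa [ZMod.natCast_zmod_val] at this
      obtain ⟨a, k, ha, hak⟩ := exists_of_mem_dualCosets_scaleCosets hqn (hall 1)
      rw [hzero a ha (hall a), zero_mul, zero_mul, neg_eq_zero] at hak
      exact one_ne_zero hak
    refine eq_zero_of_orthogonal_of_card_lt hqn hl hq hF hK hS_zero hdn (fun j hj hjd => ?_) hw hwd
    have hjn : j ≤ n := by omega
    -- The coset of n - j is in (l𝒮)* exactly in the range 1 ≤ j ≤ d - 2 guaranteed by the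
    -- hypothesis, and -(n - j) = j modulo n.
    obtain ⟨a, k, ha, hak⟩ := exists_of_mem_dualCosets_scaleCosets hqn
      (hd (n - j) (by omega) (by omega))
    refine ⟨a, k, ha, ?_⟩
    rw [← hak, Nat.cast_sub hjn]
    simp
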